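/- A biderivation on a commutative ring $R$ is a map $\{\cdot,\cdot\}:R\times R\to R$ such that $\{r,\cdot\}$ and $\{\cdot,r\}$ are (additive) derivations of $R$ for every $r\in R$. An ideal $I$ is bidifferential if $\{R,I\}\subseteq I$ and $\{I,R\}\subseteq I$; a pair $(I,J)$ of ideals is bidifferential if $\{I,R\}\subseteq I$ and $\{R,J\}\subseteq J$. A ring homomorphism $f$ is bidifferential if $f\{a,b\}=\{f(a),f(b)\}$ for all $a,b$ (the biderivation of the target then extends that of the source); it is lifting if moreover $(I,J)\mapsto(f(I)S,f(J)S)$, where $S$ is the target ring, sends bidifferential pairs of ideals to bidifferential pairs. A prime bidifferential ideal $P$ is $B$-locally-closed if it differs from the intersection of all prime bidifferential ideals strictly containing it (an empty intersection being the whole ring). Let $k$ be a field of characteristic zero with a biderivation. A $B$-variety over $k$ is an affine algebraic variety $X$ over $k$ with a biderivation on $k[X]$ extending that of $k$; a $B$-subvariety is a subvariety whose vanishing ideal is bidifferential; a $B$-point is a point which as a singleton is a $B$-subvariety; a $B$-morphism $\phi:X\to Y$ is a regular map whose comorphism $\phi^*:k[Y]\to k[X]$ is bidifferential. An irreducible $B$-variety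 $X$ is $B$-locally-closed if the zero ideal of $k[X]$ is. For a dominant $B$-morphism $\phi:X\to Y$ of irreducible $B$-varieties over $k$, let $L=k(Y)$ with the biderivation extending that of $k[Y]$. A generic $B$-fibre of $\phi$ over $L$ consists of biderivations on $L[X_L]=k[X]\otimes_kL$ and on $L[Y_L]=k[Y]\otimes_kL$, extending those of $k[X]$, $k[Y]$ and $L$, such that $k[X]\subseteq L[X_L]$ and $k[Y]\subseteq L[Y_L]$ are lifting and $\phi_L:X_L\to Y_L$ is a $B$-morphism, together with a $B$-point $\alpha\in Y_L(L)$ which is Zariski generic over $k$, such that $X_\alpha:=\phi_L^{-1}(\alpha)$ is a $B$-subvariety of $X_L$. We require in addition that $k(\alpha)=L$. The fibre $X_\alpha$ carries the biderivation induced from $L[X_L]$, and it is called $B$-locally-closed if it is irreducible over $L$ and the zero ideal of $L[X_\alpha]$ is $B$-locally-closed. **Proposition.** Let $\phi:X\to Y$ be a dominant $B$-morphism of irreducible $B$-varieties over $k$, and assume that $Y$ is $B$-locally-closed. Then for every generic $B$-fibre $X_\alpha$ of $\phi$ over $k(Y)$ (with $k(\alpha)=k(Y)$), the following are equivalent: (i)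 $X$ is $B$-locally-closed; (ii) $X_\alpha$ is $B$-locally-closed. -/

import Mathlib

open scoped TensorProduct

/-- A biderivation on a commutative ring: a map `{·,·} : R × R → R` all of whose hamiltonians
`{r,·}` and `{·,r}` are (additive) derivations of `R`.  A commutative ring together with such a
map is a bidifferential ring. -/
structure Biderivation (R : Type*) [CommRing R] where
  /-- the bracket `{·,·}` -/
  toFun : R → R → R
  add_left' : ∀ a b c, toFun (a + b) c = toFun a c + toFun b c
  add_right' : ∀ a b c, toFun a (b + c) = toFun a b + toFun a c
  leibniz_left' : ∀ a b c, toFun (a * b) c = a * toFun b c + b * toFun a c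
  leibniz_right' : ∀ a b c, toFun a (b * c) = b * toFun a c + c * toFun a b

namespace Biderivation

variable {R S : Type*} [CommRing R] [CommRing S]

instance : CoeFun (Biderivation R) (fun _ => R → R → R) := ⟨Biderivation.toFun⟩

/-- The hamiltonian `{r,·}` as a derivation. -/
def hamLeft (β : Biderivation R) (r : R) : Derivation ℤ R R :=
  Derivation.mk' (AddMonoidHom.mk' (β r) (β.add_right' r)).toIntLinearMap
    (fun a b => β.leibniz_right' r a b)

/-- The hamiltonian `{·,r}` as a derivation. -/
def hamRight (β : Biderivation R) (r : R) : Derivation ℤ R R :=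
  Derivation.mk' (AddMonoidHom.mk' (fun a => β a r) (fun a b => β.add_left' a b r)).toIntLinearMap
    (fun a b => β.leibniz_left' a b r)

/-- A pair of ideals `(I, J)` of a bidifferential ring is bidifferential if
`{I,R} ⊆ I` and `{R,J} ⊆ J`. -/
def IsBidifferentialPair (β : Biderivation R) (I J : Ideal R) : Prop :=
  (∀ a ∈ I, ∀ r, β a r ∈ I) ∧ (∀ r, ∀ b ∈ J, β r b ∈ J)

/-- An ideal `I` is bidifferential if `{R,I} ⊆ I` and `{I,R} ⊆ I`. -/
def IsBidifferential (β : Biderivation R) (I : Ideal R) : Prop :=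
  (∀ r, ∀ a ∈ I, β r a ∈ I) ∧ (∀ a ∈ I, ∀ r, β a r ∈ I)

/-- `f` is a morphism of bidifferential rings (the biderivation `γ` of `S` extends the
biderivation `β` of `R` along `f`): `f {a,b} = {f a, f b}`. -/
def IsBidifferentialHom (β : Biderivation R) (γ : Biderivation S) (f : R →+* S) : Prop :=
  ∀ a b, f (β a b) = γ (f a) (f b)

/-- A lifting extension: a morphism of bidifferential rings along which bidifferential ideal pairs
extend to bidifferential ideal pairs. -/
def IsLifting (β : Biderivation R) (γ : Biderivation S) (f : R →+* S) : Prop :=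
  IsBidifferentialHom β γ f ∧
    ∀ I J : Ideal R, β.IsBidifferentialPair I J → γ.IsBidifferentialPair (I.map f) (J.map f)

/-- `P` is `B`-locally-closed: `P` is a prime bidifferential ideal, and it is different from the
intersection of all prime bidifferential ideals that strictly contain it (where the empty
intersection is the whole ring). -/
def IsBLocallyClosed (β : Biderivation R) (P : Ideal R) : Prop :=
  P.IsPrime ∧ β.IsBidifferential P ∧
    P ≠ sInf {Q : Ideal R | Q.IsPrime ∧ β.IsBidifferential Q ∧ P < Q}

theorem quotient_congr (β : Biderivation R) {I : Ideal R} (hI : β.IsBidifferential I)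
    {a a' b b' : R} (ha : Ideal.Quotient.mk I a = Ideal.Quotient.mk I a')
    (hb : Ideal.Quotient.mk I b = Ideal.Quotient.mk I b') :
    Ideal.Quotient.mk I (β a b) = Ideal.Quotient.mk I (β a' b') := by
  rw [Ideal.Quotient.eq] at ha hb ⊢
  have h1 : β (a - a') b = β a b - β a' b := (β.hamRight b).map_sub a a'
  have h2 : β a' (b - b') = β a' b - β a' b' := (β.hamLeft a').map_sub b b'
  have h3 := I.add_mem (hI.2 _ ha b) (hI.1 a' _ hb)
  rw [h1, h2] at h3
  simpa using h3

/-- The biderivation induced on the quotient by a bidifferential ideal: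
`{a + I, b + I} = {a,b} + I`. -/
def quotient (β : Biderivation R) (I : Ideal R) (hI : β.IsBidifferential I) :
    Biderivation (R ⧸ I) where
  toFun := Quotient.lift₂ (fun a b => Ideal.Quotient.mk I (β a b)) fun _ _ _ _ ha hb =>
    β.quotient_congr hI (Quotient.sound ha) (Quotient.sound hb)
  add_left' := by
    rintro ⟨a⟩ ⟨b⟩ ⟨c⟩
    exact (congrArg (Ideal.Quotient.mk I) (β.add_left' a b c)).trans (map_add _ _ _)
  add_right' := by
    rintro ⟨a⟩ ⟨b⟩ ⟨c⟩
    exact (congrArg (Ideal.Quotient.mk I) (β.add_right' a b c)).trans (map_add _ _ _)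
  leibniz_left' := by
    rintro ⟨a⟩ ⟨b⟩ ⟨c⟩
    exact (congrArg (Ideal.Quotient.mk I) (β.leibniz_left' a b c)).trans
      (by simp only [map_add, map_mul]; rfl)
  leibniz_right' := by
    rintro ⟨a⟩ ⟨b⟩ ⟨c⟩
    exact (congrArg (Ideal.Quotient.mk I) (β.leibniz_right' a b c)).trans
      (by simp only [map_add, map_mul]; rfl)

theorem quotient_mk (β : Biderivation R) (I : Ideal R) (hI : β.IsBidifferential I) (a b : R) :
    β.quotient I hI (Ideal.Quotient.mk I a) (Ideal.Quotient.mk I b) =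
      Ideal.Quotient.mk I (β a b) := rfl

end Biderivation

/-- A `B`-variety over a bidifferential field `(k, βk)`: an affine algebraic variety over `k`, given
by its coordinate ring `k[X]` (a reduced finitely generated `k`-algebra), together with a
biderivation on `k[X]` that extends the one on `k`. -/
structure BVariety (k : Type*) [Field k] (βk : Biderivation k) where
  /-- the coordinate ring `k[X]` -/
  coordRing : Type*
  [commRing : CommRing coordRing]
  [algebra : Algebra k coordRing]
  [finiteType : Algebra.FiniteType k coordRing]
  [isReduced : IsReduced coordRing]
  /-- the biderivation on `k[X]` -/
  bracket : Biderivation coordRing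
  extends_base : Biderivation.IsBidifferentialHom βk bracket (algebraMap k coordRing)

namespace BVariety

variable {k : Type*} [Field k] {βk : Biderivation k}

attribute [instance] BVariety.commRing BVariety.algebra BVariety.finiteType BVariety.isReduced

/-- The variety is irreducible (over `k`): its coordinate ring is an integral domain. -/
def Irreducible (X : BVariety k βk) : Prop := IsDomain X.coordRing

/-- An (irreducible) `B`-variety is `B`-locally-closed if the zero ideal of its coordinate ring is
`B`-locally-closed. -/
def IsBLocallyClosed (X : BVariety k βk) : Prop :=
  X.bracket.IsBLocallyClosed ⊥

/-- The coordinate ring `L[X_L] = L ⊗ k[X]` of the base extension `X_L`. -/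
abbrev baseExtRing (X : BVariety k βk) (L : Type*) [Field L] [Algebra k L] : Type _ :=
  L ⊗[k] X.coordRing

/-- The inclusion `k[X] → L[X_L]`, `f ↦ 1 ⊗ f`. -/
abbrev toBaseExt (X : BVariety k βk) (L : Type*) [Field L] [Algebra k L] :
    X.coordRing →ₐ[k] X.baseExtRing L :=
  Algebra.TensorProduct.includeRight

/-- `γ` is a compatible `B`-variety structure on `X_L`: a biderivation on `L[X_L]` that extends the
biderivations on `k[X]` and on `L`, and for which `k[X] ⊆ L[X_L]` is a lifting extension. -/
def IsCompatibleBaseExt (X : BVariety k βk) {L : Type*} [Field L] [Algebra k L]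
    (βL : Biderivation L) (γ : Biderivation (X.baseExtRing L)) : Prop :=
  Biderivation.IsBidifferentialHom βL γ (algebraMap L (X.baseExtRing L)) ∧
    Biderivation.IsLifting X.bracket γ (X.toBaseExt L).toRingHom

end BVariety

/-- A `B`-morphism `φ : X → Y`: a regular map, given by its comorphism `φ* : k[Y] → k[X]`, such that
`φ*` is bidifferential. -/
structure BMorphism {k : Type*} [Field k] {βk : Biderivation k} (X Y : BVariety k βk) where
  /-- the comorphism `φ* : k[Y] → k[X]` -/
  comorphism : Y.coordRing →ₐ[k] X.coordRing
  bidifferential :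
    Biderivation.IsBidifferentialHom Y.bracket X.bracket comorphism.toRingHom

namespace BMorphism

variable {k : Type*} [Field k] {βk : Biderivation k} {X Y : BVariety k βk}

/-- `φ` is dominant: its image is Zariski dense. -/
def Dominant (φ : BMorphism X Y) : Prop :=
  DenseRange (PrimeSpectrum.comap φ.comorphism.toRingHom)

/-- The comorphism `L[Y_L] → L[X_L]` of the base extension `φ_L : X_L → Y_L`. -/
noncomputable abbrev baseExt (φ : BMorphism X Y) (L : Type*) [Field L] [Algebra k L] :
    Y.baseExtRing L →ₐ[L] X.baseExtRing L :=
  Algebra.TensorProduct.map (AlgHom.id L L) φ.comorphism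

/-- For an `L`-point `α` of `Y_L` (an `L`-algebra homomorphism `L[Y_L] → L`, whose kernel is the
vanishing ideal of the point), the vanishing ideal in `L[X_L]` of the fibre `φ_L⁻¹(α)`, that is,
the radical of the ideal generated by the image of the vanishing ideal of `α`. -/
noncomputable def fibreIdeal (φ : BMorphism X Y) {L : Type*} [Field L] [Algebra k L]
    (α : Y.baseExtRing L →ₐ[L] L) : Ideal (X.baseExtRing L) :=
  ((RingHom.ker α).map (φ.baseExt L)).radical

end BMorphism

/-- A generic `B`-fibre of `φ : X → Y` over a field extension `L` of `k` with biderivation `βL`. -/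
structure GenericBFibre {k : Type*} [Field k] {βk : Biderivation k} {X Y : BVariety k βk}
    (φ : BMorphism X Y) (L : Type*) [Field L] [Algebra k L] (βL : Biderivation L) where
  /-- `L` is a bidifferential field extension of `k` -/
  extends_base : Biderivation.IsBidifferentialHom βk βL (algebraMap k L)
  /-- the biderivation on `L[X_L]` -/
  bracketX : Biderivation (X.baseExtRing L)
  compatibleX : X.IsCompatibleBaseExt βL bracketX
  /-- the biderivation on `L[Y_L]` -/
  bracketY : Biderivation (Y.baseExtRing L)
  compatibleY : Y.IsCompatibleBaseExt βL bracketY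
  /-- `φ_L : X_L → Y_L` is a `B`-morphism -/
  baseExt_bidifferential :
    Biderivation.IsBidifferentialHom bracketY bracketX (φ.baseExt L).toRingHom
  /-- the `L`-point `α` of `Y_L` -/
  point : Y.baseExtRing L →ₐ[L] L
  /-- `α` is a `B`-point -/
  isBPoint : bracketY.IsBidifferential (RingHom.ker point)
  /-- `α` is Zariski generic over `k`: no nonzero `f ∈ k[Y]` vanishes at `α` -/
  generic : ∀ f : Y.coordRing, point (Y.toBaseExt L f) = 0 → f = 0
  /-- `φ_L⁻¹(α)` is a `B`-subvariety of `X_L` -/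
  isBSubvariety : bracketX.IsBidifferential (φ.fibreIdeal point)

namespace GenericBFibre

variable {k : Type*} [Field k] {βk : Biderivation k} {X Y : BVariety k βk} {φ : BMorphism X Y}
  {L : Type*} [Field L] [Algebra k L] {βL : Biderivation L}

/-- The coordinate ring `L[X_α]` of the generic `B`-fibre `X_α = φ_L⁻¹(α)`. -/
abbrev coordRing (F : GenericBFibre φ L βL) : Type _ :=
  X.baseExtRing L ⧸ φ.fibreIdeal F.point

/-- The biderivation on `L[X_α]` induced from `L[X_L]`. -/
noncomputable def bracket (F : GenericBFibre φ L βL) : Biderivation F.coordRing :=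
  F.bracketX.quotient (φ.fibreIdeal F.point) F.isBSubvariety

/-- `L` is generated as a field over `k` by the coordinates of `α`, that is, `k(α) = L`. -/
def PointGenerates (F : GenericBFibre φ L βL) : Prop :=
  IntermediateField.adjoin k (Set.range fun f : Y.coordRing => F.point (Y.toBaseExt L f)) = ⊤

/-- The generic `B`-fibre `X_α` is `B`-locally-closed: the zero ideal of `L[X_α]` is
`B`-locally-closed (in particular `X_α` is irreducible over `L`). -/
def IsBLocallyClosed (F : GenericBFibre φ L βL) : Prop :=
  F.bracket.IsBLocallyClosed ⊥

end GenericBFibre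

/-! Write `A = k[Y]`, `B = k[X]`, `C = L[X_α]`. Evaluation at `α` embeds `A` in `L` because `α` is
generic, and `k(α) = L` makes `L` the fraction field of `A` along this embedding. On the fibre each
`a ∈ A` equals the scalar `a(α)`, so `C` is `B` with the nonzero elements of `A` inverted
(`isLocalization_quotient_map_ker_radical`).

Primes of `C` are therefore the primes of `B` meeting `A` only in zero, and bidifferential ideals
extend and contract along the localization. By `isBLocallyClosed_bot_iff`, the property asks for one
nonzero element common to all nonzero bidifferential primes. The primes of `B` lost in `C` contract
to nonzero bidifferential primes of `A`; these share a nonzero element since `Y` is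
`B`-locally-closed, and multiplying by it passes from `C` back to `B`. -/

namespace Biderivation

section

variable {R S : Type*} [CommRing R] [CommRing S]

theorem map_zero_left (β : Biderivation R) (r : R) : β 0 r = 0 :=
  (β.hamRight r).map_zero

theorem map_zero_right (β : Biderivation R) (r : R) : β r 0 = 0 :=
  (β.hamLeft r).map_zero

theorem isBidifferential_bot (β : Biderivation R) : β.IsBidifferential ⊥ := by
  refine ⟨fun r a ha => ?_, fun a ha r => ?_⟩ <;> rw [Ideal.mem_bot] at ha ⊢ <;> subst ha
  · exact β.map_zero_right r
  · exact β.map_zero_left r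

/-- The contraction of a bidifferential ideal along a morphism of bidifferential rings is
bidifferential. -/
theorem IsBidifferential.comap {β : Biderivation R} {γ : Biderivation S} {f : R →+* S}
    (hf : IsBidifferentialHom β γ f) {J : Ideal S} (hJ : γ.IsBidifferential J) :
    β.IsBidifferential (J.comap f) := by
  refine ⟨fun r a ha => ?_, fun a ha r => ?_⟩ <;> rw [Ideal.mem_comap, hf]
  · exact hJ.1 _ _ ha
  · exact hJ.2 _ ha _

/-- In a domain, the zero ideal is `B`-locally-closed if and only if some nonzero element lies in
every nonzero prime bidifferential ideal. -/
theorem isBLocallyClosed_bot_iff [IsDomain R] (β : Biderivation R) :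
    β.IsBLocallyClosed ⊥ ↔
      ∃ f : R, f ≠ 0 ∧ ∀ Q : Ideal R, Q.IsPrime → β.IsBidifferential Q → Q ≠ ⊥ → f ∈ Q := by
  have key : (⊥ : Ideal R) ≠ sInf {Q : Ideal R | Q.IsPrime ∧ β.IsBidifferential Q ∧ ⊥ < Q} ↔
      ∃ f : R, f ≠ 0 ∧ ∀ Q : Ideal R, Q.IsPrime → β.IsBidifferential Q → Q ≠ ⊥ → f ∈ Q := by
    rw [ne_comm, Submodule.ne_bot_iff]
    refine exists_congr fun f => ?_
    rw [and_comm, Submodule.mem_sInf]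
    refine and_congr_right fun _ => forall_congr' fun Q => ?_
    rw [Set.mem_ofPred_eq, bot_lt_iff_ne_bot]
    tauto
  rw [← key]
  exact ⟨fun h => h.2.2, fun h => ⟨Ideal.isPrime_bot, β.isBidifferential_bot, h⟩⟩

end

end Biderivation

/-! ### Derivations, ideals and localization -/

/-- A derivation of a ring that sends a generating set of an ideal into the ideal preserves the
ideal. -/
theorem Derivation.mem_map_of_mem_map {B C : Type*} [CommRing B] [CommRing C]
    (D : Derivation ℤ C C) (f : B →+* C) (P : Ideal B) (hD : ∀ p ∈ P, D (f p) ∈ P.map f)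
    {x : C} (hx : x ∈ P.map f) : D x ∈ P.map f := by
  refine Submodule.span_induction (p := fun x _ => D x ∈ P.map f) ?_ ?_ ?_ ?_ hx
  · rintro _ ⟨p, hp, rfl⟩
    exact hD p hp
  · simp
  · intro x y _ _ hx hy
    rw [map_add]
    exact add_mem hx hy
  · intro a x hx' hx
    rw [smul_eq_mul, D.leibniz]
    exact add_mem (Ideal.mul_mem_left _ _ hx) (Ideal.mul_mem_right _ _ hx')

/-- A derivation of a localization of `B` that sends the image of `B` into an ideal takes values in
that ideal. -/
theorem Derivation.mem_of_forall_algebraMap_mem {B C : Type*} [CommRing B] [CommRing C]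
    [Algebra B C] (M : Submonoid B) [IsLocalization M C] (D : Derivation ℤ C C) (J : Ideal C)
    (hD : ∀ b, D (algebraMap B C b) ∈ J) (c : C) : D c ∈ J := by
  obtain ⟨⟨b, m⟩, h⟩ := IsLocalization.surj M c
  have hb := hD b
  -- Quotient rule: `c * m = b` gives `m * D c = D b - c * D m`, and `m` is a unit of `C`.
  rw [← h, D.leibniz, smul_eq_mul, smul_eq_mul] at hb
  have hm := (Submodule.add_mem_iff_right J (J.mul_mem_left c (hD m))).1 hb
  exact (Ideal.unit_mul_mem_iff_mem J (IsLocalization.map_units C m)).1 hm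

namespace Biderivation

/-- By the Leibniz rule in one argument it suffices to bracket `c` with generators `p ∈ P`; by the
quotient rule in the other argument, `c` may be taken from `B`. -/
theorem IsBidifferential.map_of_isLocalization {B C : Type*} [CommRing B] [CommRing C]
    [Algebra B C] (M : Submonoid B) [IsLocalization M C] {β : Biderivation B} {γ : Biderivation C}
    (hf : IsBidifferentialHom β γ (algebraMap B C)) {P : Ideal B} (hP : β.IsBidifferential P) :
    γ.IsBidifferential (P.map (algebraMap B C)) := by
  refine ⟨fun c x hx => ?_, fun x hx c => ?_⟩
  · refine (γ.hamLeft c).mem_map_of_mem_map (algebraMap B C) P (fun p hp => ?_) hx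
    refine (γ.hamRight (algebraMap B C p)).mem_of_forall_algebraMap_mem M _ (fun b => ?_) c
    have h := Ideal.mem_map_of_mem (algebraMap B C) (hP.1 b p hp)
    rw [hf] at h
    exact h
  · refine (γ.hamRight c).mem_map_of_mem_map (algebraMap B C) P (fun p hp => ?_) hx
    refine (γ.hamLeft (algebraMap B C p)).mem_of_forall_algebraMap_mem M _ (fun b => ?_) c
    have h := Ideal.mem_map_of_mem (algebraMap B C) (hP.2 p hp b)
    rw [hf] at h
    exact h

/-- Let `A → B` be an injective morphism of bidifferential domains and `C` the localization of `B`
at the nonzero elements of `A`.  If `A` is `B`-locally-closed, then `B` is if and only if `C` is. -/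
theorem isBLocallyClosed_bot_iff_of_isLocalization {A B C : Type*} [CommRing A] [CommRing B]
    [CommRing C] [IsDomain A] [IsDomain B] [Algebra B C] {βA : Biderivation A}
    {βB : Biderivation B} {βC : Biderivation C} {f : A →+* B} (hf : Function.Injective f)
    (hAB : IsBidifferentialHom βA βB f) (hBC : IsBidifferentialHom βB βC (algebraMap B C))
    [IsLocalization ((nonZeroDivisors A).map f) C] (hA : βA.IsBLocallyClosed ⊥) :
    βB.IsBLocallyClosed ⊥ ↔ βC.IsBLocallyClosed ⊥ := by
  set M := (nonZeroDivisors A).map f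
  have hM : M ≤ nonZeroDivisors B := map_le_nonZeroDivisors_of_injective f hf le_rfl
  have : IsDomain C := IsLocalization.isDomain_of_le_nonZeroDivisors C hM
  have hinj : Function.Injective (algebraMap B C) := IsLocalization.injective C hM
  rw [isBLocallyClosed_bot_iff] at hA ⊢
  rw [isBLocallyClosed_bot_iff]
  constructor
  · rintro ⟨g, hg, hgQ⟩
    refine ⟨algebraMap B C g, (map_ne_zero_iff _ hinj).2 hg, fun Q hQ hQb hQ0 => ?_⟩
    -- An ideal of a localization is extended from its contraction, so `Q ≠ ⊥` has nonzero
    -- contraction.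
    refine hgQ (Q.comap (algebraMap B C)) (hQ.comap _) (hQb.comap hBC) fun h => hQ0 ?_
    have := IsLocalization.map_under M C Q
    rw [← this, Ideal.under, h, Ideal.map_bot]
  · rintro ⟨c, hc, hcQ⟩
    obtain ⟨a, ha, haP⟩ := hA
    obtain ⟨⟨g, m⟩, hgm⟩ := IsLocalization.surj M c
    have hg : g ≠ 0 := by
      rintro rfl
      rw [map_zero] at hgm
      exact mul_ne_zero hc (IsLocalization.map_units C m).ne_zero hgm
    -- The numerator `g` of `c` handles the primes that survive in `C`; the factor `f a` handles
    -- those that meet `A` nontrivially.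
    refine ⟨f a * g, mul_ne_zero ((map_ne_zero_iff _ hf).2 ha) hg, fun P hP hPb hP0 => ?_⟩
    by_cases h0 : P.comap f = ⊥
    · have hd : Disjoint (M : Set B) P := by
        rw [Set.disjoint_left]
        rintro _ ⟨s, hs, rfl⟩ hsP
        have : s ∈ P.comap f := hsP
        rw [h0, Ideal.mem_bot] at this
        exact nonZeroDivisors.ne_zero hs this
      have hunder := IsLocalization.under_map_of_isPrime_disjoint M C hP hd
      have hcP := hcQ _ (IsLocalization.isPrime_of_isPrime_disjoint M C P hP hd)
        (hPb.map_of_isLocalization M hBC) fun h =>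
          hP0 ((Ideal.map_eq_bot_iff_of_injective hinj).1 h)
      refine P.mul_mem_left _ ?_
      rw [← hunder, Ideal.mem_comap, ← hgm]
      exact Ideal.mul_mem_right _ _ hcP
    · exact P.mul_mem_right _ (haP _ (hP.comap f) (hPb.comap hAB) h0)

end Biderivation

/-! ### The generic fibre as a localization -/

/-- If a field `L` is generated over `k` by the image of an injective algebra homomorphism from a
domain `A`, then `L` is the fraction field of `A`. -/
theorem exists_fractionRing_algEquiv {k A L : Type*} [Field k] [CommRing A] [IsDomain A]
    [Algebra k A] [Field L] [Algebra k L] (σ : A →ₐ[k] L) (hσ : Function.Injective σ)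
    (htop : IntermediateField.adjoin k (Set.range σ) = ⊤) :
    ∃ e : FractionRing A ≃ₐ[k] L, ∀ a, e (algebraMap A (FractionRing A) a) = σ a := by
  let h : FractionRing A →ₐ[k] L := IsFractionRing.liftAlgHom hσ
  have hh : ∀ a, h (algebraMap A (FractionRing A) a) = σ a := fun a =>
    IsFractionRing.lift_algebraMap (g := σ.toRingHom) hσ a
  have hr : h.fieldRange = ⊤ := by
    rw [eq_top_iff, ← htop, IntermediateField.adjoin_le_iff]
    rintro _ ⟨a, rfl⟩
    exact ⟨_, hh a⟩
  exact ⟨AlgEquiv.ofBijective h ⟨h.injective, AlgHom.fieldRange_eq_top.1 hr⟩, hh⟩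

/-- The coordinate ring of the fibre of `Spec B → Spec A` over an `L`-point of `Spec A` that is
generic over `k` and generates `L` over `k` is the localization of `B` at the nonzero elements
of `A`. -/
theorem isLocalization_quotient_map_ker_radical {k A B L : Type*} [Field k] [CommRing A]
    [CommRing B] [IsDomain A] [IsDomain B] [Algebra k A] [Algebra k B] [Field L] [Algebra k L]
    (φ : A →ₐ[k] B) (hφ : Function.Injective φ) (α : L ⊗[k] A →ₐ[L] L)
    (hα : ∀ a : A, α (1 ⊗ₜ a) = 0 → a = 0)
    (htop : IntermediateField.adjoin k (Set.range fun a : A => α (1 ⊗ₜ a)) = ⊤)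
    (I : Ideal (L ⊗[k] B))
    (hI : I = ((RingHom.ker α).map (Algebra.TensorProduct.map (AlgHom.id L L) φ)).radical) :
    letI := ((Ideal.Quotient.mk I).comp
      (Algebra.TensorProduct.includeRight : B →ₐ[k] L ⊗[k] B).toRingHom).toAlgebra
    IsLocalization ((nonZeroDivisors A).map φ.toRingHom) (L ⊗[k] B ⧸ I) := by
  let ι : B →+* L ⊗[k] B ⧸ I := (Ideal.Quotient.mk I).comp
    (Algebra.TensorProduct.includeRight : B →ₐ[k] L ⊗[k] B).toRingHom
  let _ : Algebra B (L ⊗[k] B ⧸ I) := ι.toAlgebra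
  let κ : L →+* L ⊗[k] B ⧸ I := (Ideal.Quotient.mk I).comp (algebraMap L (L ⊗[k] B))
  let σ : A →ₐ[k] L := (α.restrictScalars k).comp Algebra.TensorProduct.includeRight
  have hσ : Function.Injective σ := (injective_iff_map_eq_zero σ).2 hα
  have hαlmul : ∀ l a, α (l ⊗ₜ a) = l * σ a := by
    intro l a
    have : l ⊗ₜ[k] a = l • (1 ⊗ₜ[k] a) := by simp [TensorProduct.smul_tmul']
    rw [this, map_smul, smul_eq_mul]
    rfl
  obtain ⟨e, he⟩ := exists_fractionRing_algEquiv σ hσ htop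
  -- Functions from `A` are constant on the fibre: `1 ⊗ a - σ a ⊗ 1` vanishes at `α`.
  have hικ : ∀ a, ι (φ a) = κ (σ a) := by
    intro a
    refine Ideal.Quotient.eq.2 ?_
    rw [hI]
    refine Ideal.le_radical ?_
    have hk : (1 ⊗ₜ[k] a - σ a ⊗ₜ[k] 1 : L ⊗[k] A) ∈ RingHom.ker α := by
      rw [RingHom.mem_ker, map_sub, hαlmul, hαlmul, map_one, one_mul, mul_one, sub_self]
    have := Ideal.mem_map_of_mem (Algebra.TensorProduct.map (AlgHom.id L L) φ) hk
    simpa using this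
  have hmk : ∀ l b, Ideal.Quotient.mk I (l ⊗ₜ[k] b) = κ l * ι b := by
    intro l b
    change _ = Ideal.Quotient.mk I (l ⊗ₜ[k] 1) * Ideal.Quotient.mk I (1 ⊗ₜ[k] b)
    rw [← map_mul, Algebra.TensorProduct.tmul_mul_tmul, mul_one, one_mul]
  -- `L ⊗ B → Frac B` vanishes on the ideal of the fibre
  let g : A →ₐ[k] FractionRing B :=
    ((Algebra.ofId B (FractionRing B)).restrictScalars k).comp φ
  have hg : Function.Injective g := (IsFractionRing.injective B (FractionRing B)).comp hφ
  let τ : L →ₐ[k] FractionRing B :=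
    (IsFractionRing.liftAlgHom hg : FractionRing A →ₐ[k] FractionRing B).comp e.symm.toAlgHom
  have hτ : ∀ a, τ (σ a) = algebraMap B (FractionRing B) (φ a) := by
    intro a
    have : e.symm (σ a) = algebraMap A (FractionRing A) a := by rw [← he, e.symm_apply_apply]
    change IsFractionRing.liftAlgHom hg (e.symm (σ a)) = _
    rw [this]
    exact IsFractionRing.lift_algebraMap (g := g.toRingHom) hg a
  let Ψ : L ⊗[k] B →ₐ[k] FractionRing B :=
    Algebra.TensorProduct.lift τ ((Algebra.ofId B (FractionRing B)).restrictScalars k)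
      fun _ _ => Commute.all _ _
  have hΨ : ∀ l b, Ψ (l ⊗ₜ b) = τ l * algebraMap B (FractionRing B) b := fun l b => by
    simp [Ψ, Algebra.ofId_apply]
  have hΨφ : ∀ x, Ψ (Algebra.TensorProduct.map (AlgHom.id L L) φ x) = τ (α x) := by
    intro x
    induction x using TensorProduct.induction_on with
    | zero => simp
    | tmul l a => simp [hΨ, hαlmul, hτ]
    | add x y hx hy => simp only [map_add, hx, hy]
  have hΨI : I ≤ RingHom.ker Ψ := by
    -- The target is a field, so the kernel is prime and taking the radical costs nothing.
    have hp : (RingHom.ker Ψ).IsPrime := RingHom.ker_isPrime Ψ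
    rw [hI, hp.isRadical.radical_le_iff, Ideal.map_le_iff_le_comap]
    intro x hx
    rw [RingHom.mem_ker] at hx
    rw [Ideal.mem_comap, RingHom.mem_ker, hΨφ, hx, map_zero]
  -- `Ψ` restricts on `B` to the inclusion into its fraction field, so `I` kills no nonzero element
  -- of `B`.
  have hιinj : Function.Injective ι := by
    refine (injective_iff_map_eq_zero ι).2 fun b hb => ?_
    have h0 : Ψ (1 ⊗ₜ b) = 0 := hΨI (Ideal.Quotient.eq_zero_iff_mem.1 hb)
    rw [hΨ, map_one, one_mul] at h0
    exact (map_eq_zero_iff _ (IsFractionRing.injective B (FractionRing B))).1 h0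
  -- Clearing denominators: scalars of `L` are fractions of values `σ a`, and finite sums have a
  -- common denominator.
  have hsurj : ∀ x : L ⊗[k] B, ∃ b, ∃ s ∈ nonZeroDivisors A,
      Ideal.Quotient.mk I x * ι (φ s) = ι b := by
    intro x
    induction x using TensorProduct.induction_on with
    | zero => exact ⟨0, 1, one_mem _, by simp⟩
    | tmul l b =>
      obtain ⟨⟨a, s⟩, has⟩ := IsLocalization.surj (nonZeroDivisors A) (e.symm l)
      refine ⟨φ a * b, s, s.2, ?_⟩
      have hl : l * σ s = σ a := by
        rw [← he, ← he, ← has, map_mul, e.apply_symm_apply]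
      rw [hmk, map_mul, hικ, hικ, ← hl, map_mul]
      ring
    | add x y hx hy =>
      obtain ⟨b, s, hs, h⟩ := hx
      obtain ⟨b', s', hs', h'⟩ := hy
      refine ⟨b * φ s' + b' * φ s, s * s', mul_mem hs hs', ?_⟩
      rw [map_add, map_add, map_mul ι, map_mul ι, ← h, ← h', map_mul φ, map_mul ι]
      ring
  refine ⟨?_, ?_, ?_⟩
  · rintro ⟨_, s, hs, rfl⟩
    change IsUnit (ι (φ s))
    rw [hικ]
    exact (((map_ne_zero_iff σ hσ).2 (nonZeroDivisors.ne_zero hs)).isUnit).map κ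
  · intro c
    obtain ⟨x, rfl⟩ := Ideal.Quotient.mk_surjective c
    obtain ⟨b, s, hs, h⟩ := hsurj x
    exact ⟨(b, ⟨φ s, s, hs, rfl⟩), h⟩
  · intro x y h
    exact ⟨1, by rw [hιinj h]⟩

theorem proposition4p7 {k : Type*} [Field k] [CharZero k] (βk : Biderivation k)
    (X Y : BVariety k βk) (hX : X.Irreducible) (hY : Y.Irreducible)
    (φ : BMorphism X Y) (hφ : φ.Dominant)
    (hYlc : Y.IsBLocallyClosed)
    (L : Type*) [Field L] [Algebra Y.coordRing L] [IsFractionRing Y.coordRing L]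
    [Algebra k L] [IsScalarTower k Y.coordRing L]
    (βL : Biderivation L)
    (hβL : Biderivation.IsBidifferentialHom Y.bracket βL (algebraMap Y.coordRing L))
    (F : GenericBFibre φ L βL) (hF : F.PointGenerates) :
    X.IsBLocallyClosed ↔ F.IsBLocallyClosed := by
  have : IsDomain X.coordRing := hX
  have : IsDomain Y.coordRing := hY
  have hinj : Function.Injective φ.comorphism.toRingHom := by
    -- Dense image only makes the kernel nil; `k[Y]` being reduced, it is zero.
    have h := (PrimeSpectrum.denseRange_comap_iff_ker_le_nilRadical _).1 hφ
    rw [nilradical_eq_zero] at h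
    exact (RingHom.injective_iff_ker_eq_bot _).2 (le_bot_iff.1 h)
  let _ : Algebra X.coordRing F.coordRing :=
    ((Ideal.Quotient.mk (φ.fibreIdeal F.point)).comp (X.toBaseExt L).toRingHom).toAlgebra
  have : IsLocalization ((nonZeroDivisors Y.coordRing).map φ.comorphism.toRingHom) F.coordRing :=
    isLocalization_quotient_map_ker_radical φ.comorphism hinj F.point F.generic hF _ rfl
  have hBC : Biderivation.IsBidifferentialHom X.bracket F.bracket
      (algebraMap X.coordRing F.coordRing) := fun a b =>
    congrArg (Ideal.Quotient.mk (φ.fibreIdeal F.point)) (F.compatibleX.2.1 a b)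
  exact Biderivation.isBLocallyClosed_bot_iff_of_isLocalization hinj φ.bidifferential hBC hYlc
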